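/- For real $\beta>1$ let $T_\beta(x)=\beta x \bmod 1$ on $[0,1]$, let $d_\beta(x)=(\lfloor \beta T_\beta^{i}(x)\rfloor)_{i\ge 0}$ be the $\beta$-expansion of $x\in[0,1]$, and let $S_\beta$ be the $\beta$-shift, i.e. the closure of $\{d_\beta(x): x\in[0,1)\}$ in the product topology. Let $\mathcal C_2$ be the set of those $\beta>1$ for which $S_\beta$ is sofic (the set of all finite factors of elements of $S_\beta$ is a regular language), and put $\mathrm{diam}(\beta)=\sup\{|x-y| : x,y\in\{T_\beta^n 1\}_{n\ge 0}\}$. An infinite word is Sturmian if for every $n\ge 0$ it has exactly $n+1$ factors of length $n$. A number $\beta>1$ is maximally Sturmian if $d_\beta(1)$ is a Sturmian word whose set of letters is $\{\lfloor\beta\rfloor-1,\lfloor\beta\rfloor\}$. (1) For every $\beta>1$, either $\beta\in\mathcal C_2$ and $d_\beta(1)$ is ultimately periodic, or $\mathrm{diam}(\beta)\ge 1/\beta$ (the two alternatives do not exclude each other). (2) If $\beta$ is maximally Sturmian, then $\mathrm{diam}(\beta)=1/\beta$. -/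

import Mathlib

namespace BetaExpansion

/-- The word formed by the `n` consecutive letters of the infinite word `x` from position `k`. -/
def window {A : Type*} (x : ℕ → A) (k n : ℕ) : List A :=
  (List.range n).map fun i => x (k + i)

/-- `F_n(x)`: the set of factors of length `n` of the infinite word `x`. -/
def factorsOfLength {A : Type*} (x : ℕ → A) (n : ℕ) : Set (List A) :=
  {w | ∃ k, w = window x k n}

/-- The complexity function `P(x, n) = Card F_n(x)`. -/
noncomputable def complexity {A : Type*} (x : ℕ → A) (n : ℕ) : ℕ :=
  (factorsOfLength x n).ncard

/-- A Sturmian word: an infinite word with exactly `n + 1` factors of each length `n`.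
(`Set.ncard` of an infinite set is `0`, so the factor sets are in particular finite.) -/
def IsSturmianWord {A : Type*} (x : ℕ → A) : Prop :=
  ∀ n, complexity x n = n + 1

/-- `alph(x)`: the set of letters that occur in `x`. -/
def alph {A : Type*} (x : ℕ → A) : Set A :=
  Set.range x

/-- The infinite word `x` is ultimately periodic. -/
def IsUltimatelyPeriodic {A : Type*} (x : ℕ → A) : Prop :=
  ∃ N p, 0 < p ∧ ∀ n, N ≤ n → x (n + p) = x n

/-- `F(X)`: the language of all (finite) factors of the elements of `X`. -/
def factorLanguage {A : Type*} (X : Set (ℕ → A)) : Language A :=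
  {w | ∃ x ∈ X, ∃ n, w ∈ factorsOfLength x n}

/-- A shift space is sofic if its language of factors is regular,
that is, recognized by a finite automaton. -/
def IsSofic {A : Type*} (X : Set (ℕ → A)) : Prop :=
  (factorLanguage X).IsRegular

/-- The `β`-transformation `x ↦ β x mod 1`. -/
noncomputable def T (β x : ℝ) : ℝ :=
  Int.fract (β * x)

/-- The `β`-expansion `d_β(x)`, with letters indexed from `0`:
the letter at position `i` is `⌊β T_β^i(x)⌋`. -/
noncomputable def d (β x : ℝ) : ℕ → ℕ :=
  fun i => ⌊β * (T β)^[i] x⌋₊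

/-- The `β`-shift `S_β`: the closure of `{d_β(x) | x ∈ [0, 1)}` for the product of the discrete
topologies. All letters are at most `⌊β⌋`, and the words over a fixed finite alphabet of natural
numbers form a closed set, so it does not matter that the closure is taken among all
sequences of natural numbers. -/
def betaShift (β : ℝ) : Set (ℕ → ℕ) :=
  closure (d β '' Set.Ico 0 1)

/-- The class `𝒞₂` of those `β > 1` whose `β`-shift is sofic. -/
def C₂ : Set ℝ :=
  {β | 1 < β ∧ IsSofic (betaShift β)}

/-- `diam(β)`: the diameter of the (bounded) orbit `{T_β^n 1 | n ≥ 0}`. -/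
noncomputable def diam (β : ℝ) : ℝ :=
  Metric.diam (Set.range fun n : ℕ => (T β)^[n] 1)

/-- `β > 1` is a Sturmian number if `d_β(1)` is a Sturmian word over a binary alphabet `{a, b}`
with `0 ≤ a < b = ⌊β⌋`. -/
def IsSturmianNumber (β : ℝ) : Prop :=
  1 < β ∧ IsSturmianWord (d β 1) ∧ ∃ a : ℕ, a < ⌊β⌋₊ ∧ alph (d β 1) = {a, ⌊β⌋₊}

/-- A Sturmian number `β` is maximally Sturmian if the letters of `d_β(1)` are
`⌊β⌋ - 1` and `⌊β⌋` (note `⌊β⌋ ≥ 1`). -/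
def IsMaximallySturmian (β : ℝ) : Prop :=
  IsSturmianNumber β ∧ alph (d β 1) = {⌊β⌋₊ - 1, ⌊β⌋₊}

end BetaExpansion

/-! (1) If `d β 1` is ultimately periodic, the orbit of 1 is finite. Every left quotient of the
language of `betaShift β` is the prefix language of some `[0, c)` with `c` zero or in the orbit, so
Myhill–Nerode gives soficity. Otherwise, for every `n`, two equal factors of length `n` are preceded
by distinct letters; as `T^i 1 = (d_i + T^(i+1) 1) / β`, the orbit points starting at these letters
are at least `(1 - β^(-n)) / β` apart (`one_div_le_diam`).

(2) Sturmian words are not ultimately periodic, whence `≥`. For `≤`, the orbit lies in `[1 - 1/β,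
1]`: with `b = ⌊β⌋`, a point further left would yield factors `b u b` and `(b-1) u (b-1)` of `d β
1`, against `IsSturmianWord.balanced`. -/

namespace BetaExpansion

/-! ### Factors, periodicity and right special factors -/

section Words

variable {A : Type*} {x : ℕ → A}

theorem window_eq_iff {y : ℕ → A} {k l n : ℕ} :
    window x k n = window y l n ↔ ∀ i < n, x (k + i) = y (l + i) := by
  simp [window]

@[simp]
theorem length_window (k n : ℕ) : (window x k n).length = n := by
  simp [window]

theorem window_zero_succ (n : ℕ) :
    window x 0 (n + 1) = x 0 :: window (fun i => x (i + 1)) 0 n := by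
  simp [window, List.range_succ_eq_map]

theorem window_cons_eq {i j n : ℕ} (h0 : x i = x j)
    (h : window x (i + 1) n = window x (j + 1) n) :
    window x i (n + 1) = window x j (n + 1) := by
  rw [window_eq_iff] at h ⊢
  rintro (_ | m) hm
  · simpa using h0
  · have := h m (by omega)
    rwa [show i + 1 + m = i + (m + 1) by omega, show j + 1 + m = j + (m + 1) by omega] at this

theorem window_tail_eq {i j n : ℕ} (h : window x i (n + 1) = window x j (n + 1)) :
    window x (i + 1) n = window x (j + 1) n := by
  rw [window_eq_iff] at h ⊢
  intro m hm
  have := h (m + 1) (by omega)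
  rwa [show i + 1 + m = i + (m + 1) by omega, show j + 1 + m = j + (m + 1) by omega]

theorem window_init_eq {i j m n : ℕ} (hmn : m ≤ n) (h : window x i n = window x j n) :
    window x i m = window x j m := by
  rw [window_eq_iff] at h ⊢
  exact fun k hk => h k (by omega)

theorem window_succ_eq {i j n : ℕ} (h : window x i n = window x j n)
    (h1 : x (i + n) = x (j + n)) : window x i (n + 1) = window x j (n + 1) := by
  rw [window_eq_iff] at h ⊢
  intro k hk
  rcases Nat.lt_succ_iff_lt_or_eq.mp hk with hk | rfl
  · exact h k hk
  · exact h1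

/-- If every factor of length `n` has a unique left extension, the word is periodic. -/
theorem isUltimatelyPeriodic_of_left_deterministic {n : ℕ} (hfin : (factorsOfLength x n).Finite)
    (H : ∀ i j, window x (i + 1) n = window x (j + 1) n → x i = x j) :
    IsUltimatelyPeriodic x := by
  have back : ∀ m i j, window x (i + m) n = window x (j + m) n →
      window x i n = window x j n := by
    intro m
    induction m with
    | zero => exact fun i j h => h
    | succ m ih =>
      intro i j h
      apply ih
      exact window_init_eq (Nat.le_succ n) (window_cons_eq (H _ _ h) h)
  have : Finite (factorsOfLength x n) := hfin
  -- Some factor recurs infinitely often. Reading leftwards from two fixed occurrences at distance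
  -- `p + 1` and a third one beyond `m + p + 1` identifies the letters at `m` and `m + p + 1`.
  obtain ⟨w, hw⟩ := Finite.exists_infinite_fiber
    (fun k : ℕ => (⟨window x k n, k, rfl⟩ : factorsOfLength x n))
  set S := (fun k : ℕ => (⟨window x k n, k, rfl⟩ : factorsOfLength x n)) ⁻¹' {w} with hS
  have hSinf : S.Infinite := Set.infinite_coe_iff.mp hw
  have hSw : ∀ k ∈ S, ∀ l ∈ S, window x k n = window x l n := fun k hk l hl =>
    congrArg Subtype.val ((Set.mem_singleton_iff.mp hk).trans (Set.mem_singleton_iff.mp hl).symm)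
  obtain ⟨i, hi⟩ := hSinf.nonempty
  obtain ⟨j, hj, hij⟩ := hSinf.exists_gt i
  obtain ⟨p, rfl⟩ := Nat.exists_eq_add_of_lt hij
  refine ⟨0, p + 1, by omega, fun m _ => ?_⟩
  obtain ⟨k, hk, hmk⟩ := hSinf.exists_gt (m + p + 1)
  obtain ⟨r, rfl⟩ := Nat.exists_eq_add_of_lt hmk
  have h1 : window x i n = window x (m + r + 1) n := by
    apply back (p + 1)
    rw [show i + (p + 1) = i + p + 1 by omega,
      show m + r + 1 + (p + 1) = m + p + 1 + r + 1 by omega]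
    exact hSw _ hj _ hk
  have h2 : window x (m + p + 1 + r + 1) n = window x (m + r + 1) n :=
    (hSw _ hk _ hi).trans h1
  apply H
  apply back r
  rwa [show m + (p + 1) + 1 + r = m + p + 1 + r + 1 by omega,
    show m + 1 + r = m + r + 1 by omega]

theorem IsSturmianWord.finite_factorsOfLength (hx : IsSturmianWord x) (n : ℕ) :
    (factorsOfLength x n).Finite := by
  apply Set.finite_of_ncard_ne_zero
  have := hx n
  unfold complexity at this
  omega

theorem IsSturmianWord.not_isUltimatelyPeriodic (hx : IsSturmianWord x) :
    ¬ IsUltimatelyPeriodic x := by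
  rintro ⟨N, p, hp, h⟩
  have hsub : ∀ n k, ∃ l < N + p, window x k n = window x l n := by
    intro n k
    induction k using Nat.strong_induction_on with
    | _ k ih =>
      by_cases hk : k < N + p
      · exact ⟨k, hk, rfl⟩
      · obtain ⟨l, hl, h'⟩ := ih (k - p) (by omega)
        refine ⟨l, hl, h' ▸ ?_⟩
        rw [window_eq_iff]
        intro i _
        rw [← h (k - p + i) (by omega)]
        congr 1
        omega
  have h1 : factorsOfLength x (N + p) ⊆
      ((fun k => window x k (N + p)) '' (Finset.range (N + p) : Set ℕ)) := by
    rintro _ ⟨k, rfl⟩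
    obtain ⟨l, hl, h'⟩ := hsub (N + p) k
    exact ⟨l, by simpa using hl, h'.symm⟩
  have h2 := (Set.ncard_le_ncard h1 ((Finset.finite_toSet _).image _)).trans
    (Set.ncard_image_le (Finset.finite_toSet _))
  rw [Set.ncard_coe_finset, Finset.card_range] at h2
  have := hx (N + p)
  unfold complexity at this
  omega

/-- A Sturmian word has at most one right special factor of each length. -/
theorem IsSturmianWord.right_special_unique (hx : IsSturmianWord x) {n p p' q q' : ℕ}
    (hp : window x p n = window x p' n) (hp' : x (p + n) ≠ x (p' + n))
    (hq : window x q n = window x q' n) (hq' : x (q + n) ≠ x (q' + n)) :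
    window x p n = window x q n := by
  by_contra hne
  have take_window : ∀ k, (window x k (n + 1)).take n = window x k n := fun k => by
    simp [window, ← List.map_take, List.take_range]
  have last_ne : ∀ {k l}, x (k + n) ≠ x (l + n) → window x k (n + 1) ≠ window x l (n + 1) :=
    fun h h' => h (window_eq_iff.mp h' n (by omega))
  have hfin := hx.finite_factorsOfLength (n + 1)
  set R : Set (List A) := factorsOfLength x (n + 1) \ {window x p (n + 1), window x q (n + 1)}
  have hpq : window x p (n + 1) ≠ window x q (n + 1) := fun h =>
    hne (window_init_eq (Nat.le_succ n) h)
  have hcard : R.ncard = n := by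
    have h := hx (n + 1)
    unfold complexity at h
    rw [Set.ncard_sdiff (by rintro _ (rfl | rfl) <;> exact ⟨_, rfl⟩), h, Set.ncard_pair hpq]
    omega
  -- Each of the two right special factors keeps another extension in `R`, so `n` words would
  -- truncate onto `n + 1` factors.
  have hsub : factorsOfLength x n ⊆ List.take n '' R := by
    rintro _ ⟨k, rfl⟩
    by_cases h1 : window x k n = window x p n
    · refine ⟨window x p' (n + 1), ⟨⟨p', rfl⟩, ?_⟩, by rw [take_window, h1, hp]⟩
      rintro (h | h)
      · exact last_ne hp' h.symm
      · exact hne (hp.trans (window_init_eq (Nat.le_succ n) h))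
    · by_cases h2 : window x k n = window x q n
      · refine ⟨window x q' (n + 1), ⟨⟨q', rfl⟩, ?_⟩, by rw [take_window, h2, hq]⟩
        rintro (h | h)
        · exact hne (hq.trans (window_init_eq (Nat.le_succ n) h)).symm
        · exact last_ne hq' h.symm
      · refine ⟨window x k (n + 1), ⟨⟨k, rfl⟩, ?_⟩, take_window k⟩
        rintro (h | h)
        · exact h1 (window_init_eq (Nat.le_succ n) h)
        · exact h2 (window_init_eq (Nat.le_succ n) h)
  have hRfin : R.Finite := hfin.subset Set.sdiff_subset
  have h2 := (Set.ncard_le_ncard hsub (hRfin.image _)).trans (Set.ncard_image_le hRfin)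
  have := hx n
  unfold complexity at this
  omega

theorem isUltimatelyPeriodic_of_right_deterministic {n p q : ℕ} (hn : 0 < n) (hpq : p < q)
    (h : window x p n = window x q n)
    (H : ∀ t, p ≤ t → t < q → ∀ t', window x t' n = window x t n → x (t' + n) = x (t + n)) :
    IsUltimatelyPeriodic x := by
  have key : ∀ m, ∃ t, p ≤ t ∧ t < q ∧ window x (p + m) n = window x t n ∧
      window x (q + m) n = window x t n := by
    intro m
    induction m with
    | zero => exact ⟨p, le_rfl, hpq, rfl, h.symm⟩
    | succ m ih =>
      obtain ⟨t, h1, h2, h3, h4⟩ := ih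
      have e1 := window_tail_eq (window_succ_eq h3 (H t h1 h2 _ h3))
      have e2 := window_tail_eq (window_succ_eq h4 (H t h1 h2 _ h4))
      by_cases ht : t + 1 < q
      · exact ⟨t + 1, by omega, ht, e1, e2⟩
      · obtain rfl : t + 1 = q := by omega
        exact ⟨p, le_rfl, hpq, e1.trans h.symm, e2.trans h.symm⟩
  refine ⟨p, q - p, by omega, fun m hm => ?_⟩
  obtain ⟨t, -, -, h3, h4⟩ := key (m - p)
  have := window_eq_iff.mp (h4.trans h3.symm) 0 hn
  rwa [show q + (m - p) + 0 = m + (q - p) by omega,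
    show p + (m - p) + 0 = m by omega] at this

/-- Let `u` be the common middle factor and `c = x i`, so that the palindrome `c u c` occurs at `i`
and `c u` is not right special. As `u` is the only right special factor of length `L`, and is always
preceded by `c` in the range considered, no factor of length `L + 1` starting in `[i, i + L + 1]` is
right special. A repetition among them then forces periodicity. -/
theorem IsSturmianWord.false_of_palindrome (hx : IsSturmianWord x) {i j L : ℕ}
    (hpal : ∀ k ≤ L + 1, x (i + k) = x (i + (L + 1 - k)))
    (hmid : window x (i + 1) L = window x (j + 1) L)
    (hfst : x i ≠ x j) (hlst : x (i + (L + 1)) ≠ x (j + (L + 1)))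
    (hns : ∀ t, window x t (L + 1) = window x i (L + 1) → x (t + (L + 1)) = x (i + (L + 1))) :
    False := by
  have hend : x (i + (L + 1)) = x i := by simpa using (hpal 0 (by omega)).symm
  have hno : ∀ t, i ≤ t → t ≤ i + (L + 1) → window x (t + 1) L = window x (i + 1) L →
      x t = x i := by
    intro t h1 h2 h
    obtain ⟨s, rfl⟩ := Nat.exists_eq_add_of_le h1
    rcases Nat.eq_zero_or_pos s with rfl | hs
    · rfl
    rcases Nat.eq_or_lt_of_le (Nat.le_of_add_le_add_left h2) with rfl | hs'
    · exact hend
    -- This occurrence of `u` covers the last letter of the palindrome; reflection carries the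
    -- matching letter of `u` to position `i + s`.
    · have h3 := window_eq_iff.mp h (L - s) (by omega)
      rw [show i + s + 1 + (L - s) = i + (L + 1) by omega,
        show i + 1 + (L - s) = i + (L + 1 - s) by omega, ← hpal s (by omega)] at h3
      exact h3.symm.trans hend
  have hdet : ∀ t, i ≤ t → t ≤ i + (L + 1) → ∀ t', window x t' (L + 1) = window x t (L + 1) →
      x (t' + (L + 1)) = x (t + (L + 1)) := by
    intro t h1 h2 t' h
    by_contra hne
    have hs : window x (t' + 1) L = window x (i + 1) L :=
      hx.right_special_unique (window_tail_eq h)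
        (by rwa [show t' + 1 + L = t' + (L + 1) by omega, show t + 1 + L = t + (L + 1) by omega])
        hmid
        (by rwa [show i + 1 + L = i + (L + 1) by omega, show j + 1 + L = j + (L + 1) by omega])
    have hs' : window x (t + 1) L = window x (i + 1) L := (window_tail_eq h).symm.trans hs
    have hw : window x t (L + 1) = window x i (L + 1) := window_cons_eq (hno t h1 h2 hs') hs'
    exact hne ((hns t' (h.trans hw)).trans (hns t hw).symm)
  -- The factor at `j` is never met, which leaves `L + 1` factors for `L + 2` positions.
  have hcard : (factorsOfLength x (L + 1) \ {window x j (L + 1)}).ncard <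
      ((Finset.Icc i (i + (L + 1)) : Finset ℕ) : Set ℕ).ncard := by
    have := hx (L + 1)
    unfold complexity at this
    rw [Set.ncard_sdiff (by rintro _ rfl; exact ⟨_, rfl⟩), Set.ncard_singleton, this,
      Set.ncard_coe_finset, Nat.card_Icc]
    omega
  obtain ⟨p, hp, q, hq, hpq, he⟩ := Set.exists_ne_map_eq_of_ncard_lt_of_maps_to hcard
    (f := fun k => window x k (L + 1))
    (by
      intro t ht
      rw [Finset.mem_coe, Finset.mem_Icc] at ht
      refine ⟨⟨t, rfl⟩, fun h => ?_⟩
      have h' : window x t (L + 1) = window x j (L + 1) := h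
      have h0 := window_eq_iff.mp h' 0 (by omega)
      exact hfst ((hno t ht.1 ht.2 ((window_tail_eq h').trans hmid.symm)).symm.trans h0))
    ((hx.finite_factorsOfLength _).subset Set.sdiff_subset)
  rw [Finset.mem_coe, Finset.mem_Icc] at hp hq
  apply hx.not_isUltimatelyPeriodic
  rcases lt_or_gt_of_ne hpq with hlt | hlt
  · exact isUltimatelyPeriodic_of_right_deterministic (Nat.succ_pos L) hlt he
      fun t h1 h2 => hdet t (by omega) (by omega)
  · exact isUltimatelyPeriodic_of_right_deterministic (Nat.succ_pos L) hlt he.symm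
      fun t h1 h2 => hdet t (by omega) (by omega)

end Words

/-! ### Balance -/

/-- Sturmian words over two consecutive letters are balanced. -/
theorem IsSturmianWord.balanced {x : ℕ → ℕ} (hx : IsSturmianWord x) {a : ℕ}
    (ha : ∀ i, x i = a ∨ x i = a + 1) (n i j : ℕ) :
    ∑ k ∈ Finset.range n, x (i + k) ≤ ∑ k ∈ Finset.range n, x (j + k) + 1 := by
  induction n using Nat.strong_induction_on generalizing i j with
  | _ n ih =>
    by_contra! hlt
    let S : ℕ → ℕ → ℕ := fun i n => ∑ k ∈ Finset.range n, x (i + k)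
    have hadd : ∀ i k l, S i (k + l) = S i k + S (i + k) l := by
      intro i k l
      simp only [S, Finset.sum_range_add, add_assoc]
    have h0 : ∀ i, S i 0 = 0 := fun i => by simp [S]
    have hsucc : ∀ i k, S i (k + 1) = S i k + x (i + k) := fun i k => by
      simp only [S, Finset.sum_range_succ]
    replace ih : ∀ m < n, ∀ i j, S i m ≤ S j m + 1 := ih
    replace hlt : S j n + 1 < S i n := hlt
    obtain ⟨L, rfl⟩ : ∃ L, n = L + 2 := by
      rcases n with _ | _ | L
      · rw [h0, h0] at hlt; omega
      · rw [hsucc, hsucc, h0, h0] at hlt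
        have := ha (i + 0)
        have := ha (j + 0)
        omega
      · exact ⟨L, rfl⟩
    -- By minimality of the length, a prefix and its complementary suffix each contribute an excess
    -- of at most 1 to a total of at least 2.
    have hf : ∀ k, 0 < k → k < L + 2 → S i k = S j k + 1 := by
      intro k hk hk'
      have h1 := ih k hk' i j
      have h2 := ih (L + 2 - k) (by omega) (i + k) (j + k)
      have h3 := hadd i k (L + 2 - k)
      have h4 := hadd j k (L + 2 - k)
      rw [show k + (L + 2 - k) = L + 2 by omega] at h3 h4
      omega
    have hi0 : x i = x j + 1 := by
      have := hf 1 (by omega) (by omega)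
      simpa [S] using this
    have hiL : x (i + (L + 1)) = x (j + (L + 1)) + 1 := by
      have h1 := hf (L + 1) (by omega) (by omega)
      have h2 : S i (L + 2) = S i (L + 1) + x (i + (L + 1)) := hsucc i (L + 1)
      have h3 : S j (L + 2) = S j (L + 1) + x (j + (L + 1)) := hsucc j (L + 1)
      have := ha (i + (L + 1))
      have := ha (j + (L + 1))
      omega
    have htot : S i (L + 2) = S j (L + 2) + 2 := by
      have h1 := hf (L + 1) (by omega) (by omega)
      have h2 : S i (L + 2) = S i (L + 1) + x (i + (L + 1)) := hsucc i (L + 1)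
      have h3 : S j (L + 2) = S j (L + 1) + x (j + (L + 1)) := hsucc j (L + 1)
      omega
    -- Minimality applied to a prefix of one word against a suffix of the other makes both words
    -- palindromes.
    have hsym : ∀ k ≤ L + 2, S i k + S i (L + 2 - k) = S i (L + 2) ∧
        S j k + S j (L + 2 - k) = S j (L + 2) := by
      intro k hk
      rcases Nat.eq_zero_or_pos k with rfl | hk0
      · simp [h0]
      rcases Nat.eq_or_lt_of_le hk with rfl | hk1
      · simp [h0]
      have h1 := ih k hk1 i (j + (L + 2 - k))
      have h2 := ih k hk1 (i + (L + 2 - k)) j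
      have h3 := hadd i (L + 2 - k) k
      have h4 := hadd j (L + 2 - k) k
      rw [show L + 2 - k + k = L + 2 by omega] at h3 h4
      have h5 := hf k hk0 hk1
      have h6 := hf (L + 2 - k) (by omega) (by omega)
      omega
    have hpal : ∀ k ≤ L + 1, x (i + k) = x (i + (L + 1 - k)) ∧
        x (j + k) = x (j + (L + 1 - k)) := by
      intro k hk
      have h1 := hsym k (by omega)
      have h2 := hsym (k + 1) (by omega)
      have h3 := hsucc i k
      have h4 := hsucc j k
      have h5 := hsucc i (L + 1 - k)
      have h6 := hsucc j (L + 1 - k)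
      rw [show L + 1 - k + 1 = L + 2 - k by omega] at h5 h6
      rw [show L + 2 - (k + 1) = L + 1 - k by omega] at h2
      omega
    have hmid : window x (i + 1) L = window x (j + 1) L := by
      rw [window_eq_iff]
      intro k hk
      have h1 := hf (k + 1) (by omega) (by omega)
      have h2 := hf (k + 2) (by omega) (by omega)
      have h3 : S i (k + 2) = S i (k + 1) + x (i + (k + 1)) := hsucc i (k + 1)
      have h4 : S j (k + 2) = S j (k + 1) + x (j + (k + 1)) := hsucc j (k + 1)
      rw [show i + 1 + k = i + (k + 1) by omega, show j + 1 + k = j + (k + 1) by omega]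
      omega
    -- The two factors of length `L + 1` differ in their first letter, so at most one is right
    -- special; the other one's palindrome gives the contradiction.
    by_cases hns : ∀ t, window x t (L + 1) = window x i (L + 1) →
        x (t + (L + 1)) = x (i + (L + 1))
    · exact hx.false_of_palindrome (fun k hk => (hpal k hk).1) hmid (by omega) (by omega) hns
    · push Not at hns
      obtain ⟨t, ht, ht'⟩ := hns
      refine hx.false_of_palindrome (fun k hk => (hpal k hk).2) hmid.symm
        (by omega) (by omega) fun s hs => ?_
      by_contra hs'
      have h := hx.right_special_unique ht ht' hs hs'
      have h1 := window_eq_iff.mp (ht.symm.trans (h.trans hs)) 0 (by omega)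
      simp only [add_zero] at h1
      omega


/-! ### Orbit of 1 and the lower bound on the diameter -/

section Expansion

variable {β : ℝ}

theorem orbit_mem_Icc {y : ℝ} (hy : y ∈ Set.Icc (0 : ℝ) 1) (n : ℕ) :
    (T β)^[n] y ∈ Set.Icc (0 : ℝ) 1 := by
  cases n with
  | zero => exact hy
  | succ n =>
    rw [Function.iterate_succ_apply']
    exact ⟨Int.fract_nonneg _, (Int.fract_lt_one _).le⟩

theorem orbit_mem_Ico {y : ℝ} (hy : y ∈ Set.Ico (0 : ℝ) 1) (n : ℕ) :
    (T β)^[n] y ∈ Set.Ico (0 : ℝ) 1 := by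
  cases n with
  | zero => exact hy
  | succ n =>
    rw [Function.iterate_succ_apply']
    exact ⟨Int.fract_nonneg _, Int.fract_lt_one _⟩

theorem d_iterate (y : ℝ) (k i : ℕ) : d β ((T β)^[k] y) i = d β y (k + i) := by
  simp only [d, ← Function.iterate_add_apply, add_comm]

theorem T_eq_sub (hβ : 1 < β) {y : ℝ} (hy : 0 ≤ y) : T β y = β * y - (⌊β * y⌋₊ : ℝ) := by
  have h : 0 ≤ β * y := by positivity
  rw [T, Int.fract, natCast_floor_eq_intCast_floor h]

theorem orbit_succ (hβ : 1 < β) (n : ℕ) :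
    (T β)^[n + 1] 1 = β * (T β)^[n] 1 - (d β 1 n : ℝ) := by
  rw [Function.iterate_succ_apply']
  exact T_eq_sub hβ (orbit_mem_Icc (by simp) n).1

/-- While the letters agree, both points stay on a common affine branch of slope `β`. -/
theorem orbit_sub_of_agree (hβ : 1 < β) {i j n : ℕ}
    (h : ∀ k < n, d β 1 (i + k) = d β 1 (j + k)) :
    (T β)^[i + n] 1 - (T β)^[j + n] 1 = β ^ n * ((T β)^[i] 1 - (T β)^[j] 1) := by
  induction n with
  | zero => simp
  | succ n ih =>
    have h1 := ih fun k hk => h k (by omega)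
    rw [← add_assoc, ← add_assoc, orbit_succ hβ, orbit_succ hβ, h n (by omega), pow_succ,
      mul_right_comm, ← h1]
    ring

theorem abs_orbit_sub_le_one (n m : ℕ) : |(T β)^[n] 1 - (T β)^[m] 1| ≤ 1 := by
  have h1 := orbit_mem_Icc (β := β) (y := 1) (by simp) n
  have h2 := orbit_mem_Icc (β := β) (y := 1) (by simp) m
  rw [abs_le]
  constructor <;> linarith [h1.1, h1.2, h2.1, h2.2]

theorem abs_orbit_sub_le_of_agree (hβ : 1 < β) {i j n : ℕ}
    (h : ∀ k < n, d β 1 (i + k) = d β 1 (j + k)) :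
    |(T β)^[i] 1 - (T β)^[j] 1| ≤ (1 / β) ^ n := by
  have h1 := abs_orbit_sub_le_one (β := β) (i + n) (j + n)
  have hpos : 0 < β ^ n := by positivity
  rw [orbit_sub_of_agree hβ h, abs_mul, abs_of_pos hpos] at h1
  rw [one_div_pow, le_div_iff₀ hpos]
  linarith

theorem tendsto_one_div_pow (hβ : 1 < β) :
    Filter.Tendsto (fun n : ℕ => (1 / β) ^ n) Filter.atTop (nhds 0) :=
  tendsto_pow_atTop_nhds_zero_of_lt_one (by positivity)
    (by rw [div_lt_one (by positivity)]; exact hβ)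

theorem orbit_eq_of_agree (hβ : 1 < β) {i j : ℕ} (h : ∀ k, d β 1 (i + k) = d β 1 (j + k)) :
    (T β)^[i] 1 = (T β)^[j] 1 := by
  have := ge_of_tendsto' (tendsto_one_div_pow hβ) fun n =>
    abs_orbit_sub_le_of_agree hβ (n := n) fun k _ => h k
  exact sub_eq_zero.mp (abs_nonpos_iff.mp this)

theorem d_one_le (hβ : 1 < β) (n : ℕ) : d β 1 n ≤ ⌊β⌋₊ := by
  apply Nat.floor_le_floor
  have := (orbit_mem_Icc (β := β) (y := 1) (by simp) n).2
  nlinarith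

theorem finite_factorsOfLength_d_one (hβ : 1 < β) (n : ℕ) :
    (factorsOfLength (d β 1) n).Finite := by
  apply ((List.finite_length_eq (Fin (⌊β⌋₊ + 1)) n).image (List.map Fin.val)).subset
  rintro _ ⟨k, rfl⟩
  refine ⟨(List.range n).map fun i => ⟨d β 1 (k + i), Nat.lt_succ_of_le (d_one_le hβ _)⟩,
    by simp, ?_⟩
  simp [window, Function.comp_def]

theorem dist_orbit_le_diam (m n : ℕ) :
    |(T β)^[m] 1 - (T β)^[n] 1| ≤ diam β := by
  have hb : Bornology.IsBounded (Set.range fun n : ℕ => (T β)^[n] 1) :=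
    (Metric.isBounded_Icc (0 : ℝ) 1).subset
      (Set.range_subset_iff.mpr fun n => orbit_mem_Icc (by simp) n)
  exact Metric.dist_le_diam_of_mem hb ⟨m, rfl⟩ ⟨n, rfl⟩

theorem one_div_le_diam (hβ : 1 < β) (h : ¬ IsUltimatelyPeriodic (d β 1)) :
    1 / β ≤ diam β := by
  have hβ0 : 0 < β := by positivity
  have key : ∀ n : ℕ, 1 / β - (1 / β) ^ n / β ≤ diam β := by
    intro n
    obtain ⟨i, j, hw, hne⟩ : ∃ i j, window (d β 1) (i + 1) n = window (d β 1) (j + 1) n ∧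
        d β 1 i < d β 1 j := by
      by_contra! H
      exact h (isUltimatelyPeriodic_of_left_deterministic (finite_factorsOfLength_d_one hβ n)
        fun i j hij => le_antisymm (H j i hij.symm) (H i j hij))
    have h1 := (abs_le.mp (abs_orbit_sub_le_of_agree hβ (window_eq_iff.mp hw))).2
    rw [orbit_succ hβ, orbit_succ hβ] at h1
    have h2 : (d β 1 i : ℝ) + 1 ≤ d β 1 j := by exact_mod_cast hne
    refine le_trans ?_ ((le_abs_self _).trans (dist_orbit_le_diam j i))
    rw [← sub_div, div_le_iff₀ hβ0]
    linarith
  have hlim := ((tendsto_one_div_pow hβ).div_const β).const_sub (1 / β)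
  rw [zero_div, sub_zero] at hlim
  exact le_of_tendsto' hlim key

/-! ### Soficity -/

/-- The words that begin the `β`-expansion of some point of `[0, c)`. -/
def prefixLanguage (β c : ℝ) : Language ℕ :=
  {w | ∃ y ∈ Set.Ico 0 c, window (d β y) 0 w.length = w}

theorem mem_prefixLanguage {c : ℝ} {w : List ℕ} :
    w ∈ prefixLanguage β c ↔ ∃ y ∈ Set.Ico 0 c, window (d β y) 0 w.length = w := Iff.rfl

theorem cons_mem_prefixLanguage {c : ℝ} {a : ℕ} {w : List ℕ} :
    a :: w ∈ prefixLanguage β c ↔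
      ∃ y ∈ Set.Ico 0 c, ⌊β * y⌋₊ = a ∧ window (d β (T β y)) 0 w.length = w := by
  simp only [mem_prefixLanguage, List.length_cons, window_zero_succ, List.cons.injEq]
  rfl

/-- Cylinders are open, so the closure adds no factors; `[0, 1)` is `T`-stable, so every factor is
already a prefix. -/
theorem factorLanguage_betaShift (β : ℝ) :
    factorLanguage (betaShift β) = prefixLanguage β 1 := by
  ext w
  constructor
  · rintro ⟨x, hx, n, k, rfl⟩
    have hopen : IsOpen {y : ℕ → ℕ | ∀ i < n, y (k + i) = x (k + i)} := by
      have : {y : ℕ → ℕ | ∀ i < n, y (k + i) = x (k + i)} =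
          ⋂ i ∈ Finset.range n, (fun y : ℕ → ℕ => y (k + i)) ⁻¹' {x (k + i)} := by
        ext y
        simp
      rw [this]
      exact isOpen_biInter_finset fun i _ =>
        (isOpen_discrete _).preimage (continuous_apply (k + i))
    obtain ⟨_, hy, y, hy1, rfl⟩ := mem_closure_iff.mp hx _ hopen fun i _ => rfl
    refine mem_prefixLanguage.mpr ⟨(T β)^[k] y, orbit_mem_Ico hy1 k, ?_⟩
    rw [length_window, window_eq_iff]
    intro i hi
    rw [d_iterate, zero_add]
    exact hy i hi
  · rintro ⟨y, hy, hw⟩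
    exact ⟨d β y, subset_closure ⟨y, hy, rfl⟩, w.length, 0, hw.symm⟩

/-- The three values correspond to the cylinder `[a/β, (a+1)/β)` lying right of `c`, lying left of
`c`, or being cut by `c`. -/
theorem leftQuotient_singleton_prefixLanguage (hβ : 1 < β) {c : ℝ} (hc : 0 ≤ c) (a : ℕ) :
    ∃ c', (c' = 0 ∨ c' = 1 ∨ c' = T β c) ∧
      (prefixLanguage β c).leftQuotient [a] = prefixLanguage β c' := by
  have hβ0 : 0 < β := by positivity
  have floor_div : ∀ z : ℝ, 0 ≤ z → z < 1 → ⌊β * ((a + z) / β)⌋₊ = a := by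
    intro z hz hz1
    rw [mul_div_cancel₀ _ hβ0.ne', Nat.floor_eq_iff (by positivity)]
    constructor <;> linarith
  have T_div : ∀ z : ℝ, 0 ≤ z → z < 1 → T β ((a + z) / β) = z := by
    intro z hz hz1
    rw [T_eq_sub hβ (by positivity), floor_div z hz hz1, mul_div_cancel₀ _ hβ0.ne']
    ring
  -- `T β` maps the points of `[0, c)` with first letter `a` onto `[0, min (β * c - a) 1)`.
  have key : (prefixLanguage β c).leftQuotient [a] = prefixLanguage β (min (β * c - a) 1) := by
    ext w
    rw [Language.mem_leftQuotient, List.singleton_append, cons_mem_prefixLanguage,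
      mem_prefixLanguage]
    constructor
    · rintro ⟨y, hy, rfl, hw⟩
      refine ⟨T β y, ⟨Int.fract_nonneg _, lt_min ?_ (Int.fract_lt_one _)⟩, hw⟩
      rw [T_eq_sub hβ hy.1]
      have := mul_lt_mul_of_pos_left hy.2 hβ0
      linarith
    · rintro ⟨z, ⟨hz, hzc⟩, hw⟩
      obtain ⟨hzc, hz1⟩ := lt_min_iff.mp hzc
      refine ⟨(a + z) / β, ⟨by positivity, ?_⟩, floor_div z hz hz1, ?_⟩
      · rw [div_lt_iff₀ hβ0]
        linarith
      · rwa [T_div z hz hz1]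
  rcases le_or_gt (β * c) a with h1 | h1
  · refine ⟨0, Or.inl rfl, key.trans ?_⟩
    ext w
    simp only [mem_prefixLanguage, Set.Ico_self, Set.mem_empty_iff_false, false_and, exists_false,
      iff_false]
    rintro ⟨y, ⟨hy, hyc⟩, -⟩
    linarith [(lt_min_iff.mp hyc).1]
  · rcases le_or_gt ((a : ℝ) + 1) (β * c) with h2 | h2
    · exact ⟨1, by simp, by rw [key, min_eq_right (by linarith)]⟩
    · refine ⟨T β c, by simp, ?_⟩
      have hfl : ⌊β * c⌋₊ = a := (Nat.floor_eq_iff (by positivity)).mpr ⟨h1.le, h2⟩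
      rw [key, min_eq_left (by linarith), T_eq_sub hβ hc, hfl]

theorem isRegular_prefixLanguage (hβ : 1 < β)
    (h : (Set.range fun n : ℕ => (T β)^[n] 1).Finite) : (prefixLanguage β 1).IsRegular := by
  apply Language.IsRegular.of_finite_range_leftQuotient
  set C : Set ℝ := insert 0 (Set.range fun n : ℕ => (T β)^[n] 1) with hC
  have h1C : (1 : ℝ) ∈ C := Or.inr ⟨0, rfl⟩
  have hstep : ∀ c ∈ C, 0 ≤ c ∧ T β c ∈ C := by
    rintro c (rfl | ⟨n, rfl⟩)
    · exact ⟨le_rfl, Or.inl (by simp [T])⟩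
    · exact ⟨(orbit_mem_Icc (by simp) n).1, Or.inr ⟨n + 1, Function.iterate_succ_apply' _ _ _⟩⟩
  have key : ∀ (w : List ℕ), ∀ c ∈ C, ∃ c' ∈ C,
      prefixLanguage β c' = (prefixLanguage β c).leftQuotient w := by
    intro w
    induction w with
    | nil => exact fun c hc => ⟨c, hc, rfl⟩
    | cons a w ih =>
      intro c hc
      obtain ⟨hc0, hcT⟩ := hstep c hc
      obtain ⟨c₁, hc₁, he⟩ := leftQuotient_singleton_prefixLanguage hβ hc0 a
      obtain ⟨c₂, hc₂, he₂⟩ := ih c₁ (by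
        rcases hc₁ with rfl | rfl | rfl
        · exact Or.inl rfl
        · exact h1C
        · exact hcT)
      refine ⟨c₂, hc₂, ?_⟩
      rw [← List.singleton_append, Language.leftQuotient_append, he, he₂]
  refine ((h.insert 0).image (prefixLanguage β)).subset ?_
  rintro _ ⟨w, rfl⟩
  exact key w 1 h1C

theorem mem_C₂_of_isUltimatelyPeriodic (hβ : 1 < β) (h : IsUltimatelyPeriodic (d β 1)) :
    β ∈ C₂ := by
  refine ⟨hβ, ?_⟩
  rw [IsSofic, factorLanguage_betaShift]
  apply isRegular_prefixLanguage hβ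
  obtain ⟨N, p, hp, h⟩ := h
  have hper : ∀ n, N ≤ n → (T β)^[n + p] 1 = (T β)^[n] 1 := fun n hn =>
    orbit_eq_of_agree hβ fun k => by
      rw [add_right_comm]
      exact h _ (by omega)
  refine ((Finset.range (N + p)).finite_toSet.image fun n => (T β)^[n] 1).subset ?_
  rintro _ ⟨n, rfl⟩
  induction n using Nat.strong_induction_on with
  | _ n ih =>
    by_cases hn : n < N + p
    · exact ⟨n, by simpa using hn, rfl⟩
    · obtain ⟨m, hm, he⟩ := ih (n - p) (by omega)
      refine ⟨m, hm, he.trans ?_⟩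
      have := hper (n - p) (by omega)
      rw [show n - p + p = n by omega] at this
      exact this.symm

/-! ### The maximally Sturmian case -/

theorem IsMaximallySturmian.one_sub_one_div_le_orbit (h : IsMaximallySturmian β) (j : ℕ) :
    1 - 1 / β ≤ (T β)^[j] 1 := by
  obtain ⟨⟨hβ, hst, -⟩, halph⟩ := h
  have hβ0 : 0 < β := by positivity
  have hb : 1 ≤ ⌊β⌋₊ := (Nat.one_le_floor_iff β).mpr hβ.le
  have hbβ : (⌊β⌋₊ : ℝ) ≤ β := Nat.floor_le hβ0.le
  have hlet : ∀ i, d β 1 i = ⌊β⌋₊ - 1 ∨ d β 1 i = ⌊β⌋₊ - 1 + 1 := by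
    intro i
    have : d β 1 i ∈ alph (d β 1) := ⟨i, rfl⟩
    rw [halph] at this
    rcases this with h | h
    · exact Or.inl h
    · exact Or.inr (by rw [h]; omega)
  have hbal := hst.balanced hlet
  have h0 : d β 1 0 = ⌊β⌋₊ := by simp [d]
  by_contra! hlt
  have hlt' : β * (T β)^[j] 1 < β - 1 := by
    have := mul_lt_mul_of_pos_left hlt hβ0
    rwa [mul_sub, mul_one_div_cancel hβ0.ne', mul_one] at this
  have hj : d β 1 j = ⌊β⌋₊ - 1 := by
    rcases hlet j with h | h
    · exact h
    · have h1 : (d β 1 j : ℝ) ≤ β * (T β)^[j] 1 :=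
        Nat.floor_le (mul_nonneg hβ0.le (orbit_mem_Icc (by simp) j).1)
      have h2 := Nat.lt_floor_add_one β
      rw [h, Nat.sub_add_cancel hb] at h1
      linarith
  -- The letters at `j` and 0 are `b - 1` and `b`, yet the images keep their order. Hence at the
  -- first later disagreement the letters are again `b - 1` and `b`, and the sums differ by 2.
  have hlt1 : (T β)^[j + 1] 1 < (T β)^[0 + 1] 1 := by
    rw [orbit_succ hβ, orbit_succ hβ, hj, h0, Nat.cast_sub hb]
    simp only [Function.iterate_zero, id_eq, Nat.cast_one]
    linarith
  have hex : ∃ k, d β 1 (j + 1 + k) ≠ d β 1 (0 + 1 + k) := by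
    by_contra! hall
    exact hlt1.ne (orbit_eq_of_agree hβ hall)
  classical
  have hmin : ∀ m < Nat.find hex, d β 1 (j + 1 + m) = d β 1 (0 + 1 + m) :=
    fun m hm => not_not.mp (Nat.find_min hex hm)
  have hne := Nat.find_spec hex
  generalize Nat.find hex = k at hmin hne
  have hk := orbit_sub_of_agree hβ hmin
  have hk' : (T β)^[j + 1 + k] 1 ≤ (T β)^[0 + 1 + k] 1 := by
    have : β ^ k * ((T β)^[j + 1] 1 - (T β)^[0 + 1] 1) ≤ 0 :=
      mul_nonpos_of_nonneg_of_nonpos (by positivity) (by linarith)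
    linarith
  have hle : d β 1 (j + 1 + k) ≤ d β 1 (0 + 1 + k) :=
    Nat.floor_le_floor (mul_le_mul_of_nonneg_left hk' hβ0.le)
  have hb2 := hbal (k + 2) 0 j
  rw [Finset.sum_range_succ, Finset.sum_range_succ', Finset.sum_range_succ,
    Finset.sum_range_succ'] at hb2
  have hsum : ∑ m ∈ Finset.range k, d β 1 (j + (m + 1)) =
      ∑ m ∈ Finset.range k, d β 1 (0 + (m + 1)) := by
    refine Finset.sum_congr rfl fun m hm => ?_
    have := hmin m (Finset.mem_range.mp hm)
    rwa [add_assoc, add_assoc, add_comm 1 m] at this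
  have e1 : j + 1 + k = j + (k + 1) := by omega
  have e2 : 0 + 1 + k = 0 + (k + 1) := by omega
  rw [e1, e2] at hle hne
  rw [hsum] at hb2
  simp only [add_zero] at hb2
  have := hlet (0 + (k + 1))
  have := hlet (j + (k + 1))
  omega

theorem IsMaximallySturmian.diam_eq (h : IsMaximallySturmian β) : diam β = 1 / β := by
  have hβ := h.1.1
  have hβ0 : 0 < β := by positivity
  refine le_antisymm ?_ (one_div_le_diam hβ h.1.2.1.not_isUltimatelyPeriodic)
  apply Metric.diam_le_of_forall_dist_le (by positivity)
  rintro _ ⟨m, rfl⟩ _ ⟨n, rfl⟩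
  have h1 := h.one_sub_one_div_le_orbit m
  have h2 := h.one_sub_one_div_le_orbit n
  have h3 := (orbit_mem_Icc (β := β) (y := 1) (by simp) m).2
  have h4 := (orbit_mem_Icc (β := β) (y := 1) (by simp) n).2
  rw [Real.dist_eq, abs_le]
  constructor <;> linarith

end Expansion

end BetaExpansion

theorem mainTheorem8 :
    (∀ β : ℝ, 1 < β →
      (β ∈ BetaExpansion.C₂ ∧ BetaExpansion.IsUltimatelyPeriodic (BetaExpansion.d β 1)) ∨
        1 / β ≤ BetaExpansion.diam β) ∧
    (∀ β : ℝ, BetaExpansion.IsMaximallySturmian β → BetaExpansion.diam β = 1 / β) := by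
  refine ⟨fun β hβ => ?_, fun β h => h.diam_eq⟩
  by_cases h : BetaExpansion.IsUltimatelyPeriodic (BetaExpansion.d β 1)
  · exact Or.inl ⟨BetaExpansion.mem_C₂_of_isUltimatelyPeriodic hβ h, h⟩
  · exact Or.inr (BetaExpansion.one_div_le_diam hβ h)
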